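/- Let $R$ be an integral domain (commutative) and let $i:\mathbf{Mod}_R\to\mathbb R_{\ge 0}\cup\{\infty\}$ be a length function, i.e. $i(0)=0$, $i(M)=i(N)$ whenever $M\cong N$, $i(M)=i(N)+i(M/N)$ for every submodule $N\le M$, and $i(M)=\sup\{i(F): F\le M \text{ finitely generated}\}$ for every $R$-module $M$. Assume that $i\not\equiv 0$ and $i(R)<\infty$. An algebraic flow is a pair $(M,\phi)$ of an $R$-module $M$ and an endomorphism $\phi$ of $M$; these are the objects of $\mathbf{Flow}_R$. Put $$\mathrm{ent}_i(\phi)=\sup\Big\{\lim_{n\to\infty}\tfrac1n\, i\big(F+\phi(F)+\dots+\phi^{n-1}(F)\big) : F\le M,\ i(F)<\infty\Big\},$$ let $\mathbf P_{\mathrm{ent}_i}(M,\phi)$ be the sum of all $\phi$-invariant submodules $N\le M$ with $\mathrm{ent}_i(\phi\restriction_N)=0$ (the Pinsker radical), and let $$\mathfrak W(M,\phi)=\{x\in M: p(\phi)(x)=0 \text{ for some } p\in R[t]\setminus\{0\}\}.$$ Then $\mathbf P_{\mathrm{ent}_i}(M,\phi)=\mathfrak W(M,\phi)$ for every algebraic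 flow $(M,\phi)$; moreover, $\mathrm{ent}_i(\phi)=0$ if and only if $\phi$ is pointwise algebraic, that is, $\mathfrak W(M,\phi)=M$. -/

import Mathlib

open Filter Topology Polynomial
open scoped ENNReal

universe u

namespace AlgFlow

/-- A length function on the category of `R`-modules: an isomorphism-invariant function with values
in `[0, ∞]`, vanishing on zero modules, which is additive and upper continuous. -/
structure IsLengthFunction {R : Type u} [Ring R] (i : ModuleCat.{u} R → ℝ≥0∞) : Prop where
  zero : ∀ M : ModuleCat.{u} R, Subsingleton M → i M = 0
  iso : ∀ M N : ModuleCat.{u} R, Nonempty (M ≅ N) → i M = i N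
  additive : ∀ (M : ModuleCat.{u} R) (N : Submodule R M),
    i M = i (ModuleCat.of R N) + i (ModuleCat.of R (M ⧸ N))
  upperContinuous : ∀ M : ModuleCat.{u} R,
    i M = ⨆ (F : Submodule R M) (_ : F.FG), i (ModuleCat.of R F)

/-- An algebraic flow `(M, φ)`: an `R`-module with an endomorphism, i.e. an object of `Flow_R`. -/
structure Flow (R : Type u) [Ring R] where
  /-- the underlying module -/
  carrier : ModuleCat.{u} R
  /-- the endomorphism -/
  map : Module.End R carrier

/-- The flow `(N, φ↾N)` on a `φ`-invariant submodule `N`. The subobjects of `(M, φ)` in `Flow_R`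
are exactly the flows of this form. -/
def Flow.restrict {R : Type u} [Ring R] (X : Flow R) (N : Submodule R X.carrier)
    (hN : ∀ x ∈ N, X.map x ∈ N) : Flow R where
  carrier := ModuleCat.of R N
  map := LinearMap.restrict X.map hN

/-- The `n`-th trajectory `T_n(φ, F) = F + φ(F) + ⋯ + φ^(n-1)(F)`. -/
def trajectory {R M : Type u} [Ring R] [AddCommGroup M] [Module R M]
    (φ : Module.End R M) (F : Submodule R M) (n : ℕ) : Submodule R M :=
  (Finset.range n).sup fun k => F.map (φ ^ k)

/-- `H_i(φ, F) = lim i(T_n(φ, F)) / n`. It is written as a limit superior; see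
`tendsto_entropyAt` for the existence of the limit when `i(F) < ∞`. -/
noncomputable def entropyAt {R : Type u} [Ring R] (i : ModuleCat.{u} R → ℝ≥0∞) (X : Flow R)
    (F : Submodule R X.carrier) : ℝ≥0∞ :=
  limsup (fun n : ℕ => i (ModuleCat.of R (trajectory X.map F n)) / n) atTop

/-- The algebraic `i`-entropy `ent_i(φ) = sup {H_i(φ, F) : F ≤ M, i(F) < ∞}`. -/
noncomputable def entropy {R : Type u} [Ring R] (i : ModuleCat.{u} R → ℝ≥0∞) (X : Flow R) :
    ℝ≥0∞ :=
  ⨆ (F : Submodule R X.carrier) (_ : i (ModuleCat.of R F) < ∞), entropyAt i X F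

/-- The Pinsker radical `P_h(M, φ)` of a function `h` on `Flow_R`: the join of all subobjects of
`(M, φ)` on which `h` vanishes. -/
def pinskerRadical {R : Type u} [Ring R] (h : Flow R → ℝ≥0∞) (X : Flow R) :
    Submodule R X.carrier :=
  sSup {N | ∃ hN : ∀ x ∈ N, X.map x ∈ N, h (X.restrict N hN) = 0}

/-- `φ` is pointwise algebraic: every element is annihilated by some `p(φ)`, `p ∈ R[t] \ {0}`. -/
def Flow.PointwiseAlgebraic {R : Type u} [CommRing R] (X : Flow R) : Prop :=
  ∀ x : X.carrier, ∃ p : R[X], p ≠ 0 ∧ aeval X.map p x = 0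

/-- The radical `𝔚(M, φ) = {x ∈ M : p(φ)(x) = 0 for some p ∈ R[t] \ {0}}` over a domain. -/
def algebraicRadical {R : Type u} [CommRing R] [IsDomain R] (X : Flow R) :
    Submodule R X.carrier where
  carrier := {x | ∃ p : R[X], p ≠ 0 ∧ aeval X.map p x = 0}
  zero_mem' := ⟨1, one_ne_zero, map_zero _⟩
  add_mem' := by
    rintro x y ⟨p, hp, hx⟩ ⟨q, hq, hy⟩
    refine ⟨p * q, mul_ne_zero hp hq, ?_⟩
    rw [map_add]
    conv_lhs => arg 1; rw [mul_comm p q]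
    simp [hx, hy]
  smul_mem' := by
    rintro c x ⟨p, hp, hx⟩
    exact ⟨p, hp, by rw [map_smul, hx, smul_zero]⟩

/-- `P_h(M, φ)` is a subobject of `(M, φ)` in `Flow_R`. -/
theorem pinskerRadical_invariant {R : Type u} [Ring R] (h : Flow R → ℝ≥0∞) (X : Flow R) :
    ∀ x ∈ pinskerRadical h X, X.map x ∈ pinskerRadical h X := by
  have H : pinskerRadical h X ≤ (pinskerRadical h X).comap X.map := by
    refine sSup_le ?_
    rintro N ⟨hN, h0⟩ x hx
    exact (le_sSup (a := N) ⟨hN, h0⟩ : N ≤ pinskerRadical h X) (hN x hx)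
  exact H

/-- `𝔚(M, φ)` is a subobject of `(M, φ)` in `Flow_R`. -/
theorem algebraicRadical_invariant {R : Type u} [CommRing R] [IsDomain R] (X : Flow R) :
    ∀ x ∈ algebraicRadical X, X.map x ∈ algebraicRadical X := by
  rintro x ⟨p, hp, hx⟩
  refine ⟨p, hp, ?_⟩
  have h1 : aeval X.map (p * Polynomial.X) x = aeval X.map (Polynomial.X * p) x := by
    rw [mul_comm]
  simpa [hx] using h1

namespace IsLengthFunction

variable {R : Type u} [Ring R] {i : ModuleCat.{u} R → ℝ≥0∞}

theorem of_equiv (hi : IsLengthFunction i) {M N : Type u} [AddCommGroup M] [Module R M]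
    [AddCommGroup N] [Module R N] (e : M ≃ₗ[R] N) : i (ModuleCat.of R M) = i (ModuleCat.of R N) :=
  hi.iso _ _ ⟨e.toModuleIso⟩

theorem le_of_surjective (hi : IsLengthFunction i) {M N : Type u} [AddCommGroup M] [Module R M]
    [AddCommGroup N] [Module R N] (f : M →ₗ[R] N) (hf : Function.Surjective f) :
    i (ModuleCat.of R N) ≤ i (ModuleCat.of R M) := by
  have h := hi.additive (ModuleCat.of R M) (LinearMap.ker f)
  rw [h, ← hi.of_equiv (f.quotKerEquivOfSurjective hf)]
  exact le_add_self

theorem sup_le_add (hi : IsLengthFunction i) {M : Type u} [AddCommGroup M] [Module R M]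
    (A B : Submodule R M) : i (ModuleCat.of R (A ⊔ B : Submodule R M)) ≤
      i (ModuleCat.of R A) + i (ModuleCat.of R B) := by
  have h := hi.additive (ModuleCat.of R (A ⊔ B : Submodule R M)) (A.submoduleOf (A ⊔ B))
  have h1 := hi.of_equiv (Submodule.submoduleOfEquivOfLe (le_sup_left : A ≤ A ⊔ B))
  have h2 : i (ModuleCat.of R ((A ⊔ B : Submodule R M) ⧸ A.submoduleOf (A ⊔ B))) ≤
      i (ModuleCat.of R B) := by
    refine hi.le_of_surjective
      ((A.submoduleOf (A ⊔ B)).mkQ ∘ₗ Submodule.inclusion (le_sup_right : B ≤ A ⊔ B)) ?_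
    intro y
    obtain ⟨⟨z, hz⟩, rfl⟩ := Submodule.mkQ_surjective _ y
    obtain ⟨a, ha, b, hb, rfl⟩ := Submodule.mem_sup.1 hz
    refine ⟨⟨b, hb⟩, ?_⟩
    simp only [LinearMap.comp_apply, Submodule.mkQ_apply]
    rw [Submodule.Quotient.eq]
    simpa [Submodule.submoduleOf] using ha
  rw [h, h1]
  gcongr

theorem trajectory_add_le (hi : IsLengthFunction i) {M : Type u} [AddCommGroup M] [Module R M]
    (φ : Module.End R M) (F : Submodule R M) (m n : ℕ) :
    i (ModuleCat.of R (trajectory φ F (m + n))) ≤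
      i (ModuleCat.of R (trajectory φ F m)) + i (ModuleCat.of R (trajectory φ F n)) := by
  have h : trajectory φ F (m + n) = trajectory φ F m ⊔ (trajectory φ F n).map (φ ^ m) := by
    induction n with
    | zero => simp [trajectory]
    | succ n ih =>
      have e (k : ℕ) : trajectory φ F (k + 1) = trajectory φ F k ⊔ F.map (φ ^ k) := by
        simp [trajectory, Finset.range_add_one, sup_comm]
      rw [← add_assoc, e, e, ih, Submodule.map_sup, pow_add, sup_assoc]
      congr 2
      exact Submodule.map_comp _ _ _
  rw [h]
  refine (hi.sup_le_add _ _).trans ?_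
  gcongr
  exact hi.le_of_surjective ((φ ^ m).submoduleMap _) (LinearMap.submoduleMap_surjective _ _)

end IsLengthFunction

/-- The limit defining `H_i(φ, F)` exists for every `F` with `i(F) < ∞`. -/
theorem tendsto_entropyAt {R : Type u} [Ring R] {i : ModuleCat.{u} R → ℝ≥0∞}
    (hi : IsLengthFunction i) (X : Flow R) (F : Submodule R X.carrier)
    (hF : i (ModuleCat.of R F) < ∞) :
    Tendsto (fun n : ℕ => i (ModuleCat.of R (trajectory X.map F n)) / n) atTop
      (𝓝 (entropyAt i X F)) := by
  set a : ℕ → ℝ≥0∞ := fun n => i (ModuleCat.of R (trajectory X.map F n)) with ha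
  have hadd : ∀ m n, a (m + n) ≤ a m + a n := hi.trajectory_add_le X.map F
  have h1 : a 1 < ∞ := by
    have e : trajectory X.map F 1 = F := by
      simp [trajectory, Module.End.one_eq_id]
    simp only [ha]
    rw [e]
    exact hF
  have h0 : a 0 = 0 := hi.zero _ (by
    simp only [trajectory, Finset.range_zero, Finset.sup_empty]
    exact inferInstanceAs (Subsingleton (⊥ : Submodule R X.carrier)))
  have hfin : ∀ n, a n ≠ ∞ := by
    intro n
    induction n with
    | zero => simp [h0]
    | succ n ih => exact ((hadd n 1).trans_lt (ENNReal.add_lt_top.2 ⟨ih.lt_top, h1⟩)).ne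
  have hsub : Subadditive fun n => (a n).toReal := fun m n => by
    rw [← ENNReal.toReal_add (hfin m) (hfin n)]
    exact ENNReal.toReal_mono (ENNReal.add_ne_top.2 ⟨hfin m, hfin n⟩) (hadd m n)
  have hlim := hsub.tendsto_lim ⟨0, by rintro _ ⟨n, rfl⟩; positivity⟩
  have key : Tendsto (fun n : ℕ => a n / n) atTop (𝓝 (ENNReal.ofReal hsub.lim)) := by
    refine (ENNReal.tendsto_ofReal hlim).congr' ?_
    filter_upwards [eventually_gt_atTop 0] with n hn
    rw [ENNReal.ofReal_div_of_pos (by positivity), ENNReal.ofReal_toReal (hfin n),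
      ENNReal.ofReal_natCast]
  have e : entropyAt i X F = ENNReal.ofReal hsub.lim := key.limsup_eq
  rw [e]
  exact key

end AlgFlow

namespace AlgFlow

open Submodule

/-! Everything rests on `entropy_eq_zero_iff`. Applied to restricted flows, it says that an
invariant submodule has zero entropy exactly when it lies in 𝔚, so 𝔚 is the largest such submodule.

If no nonzero polynomial in φ kills x, each step of the trajectory of Rx adds a free cyclic
quotient, so the entropy is at least i(R), which is nonzero. If p(φ)(x) = 0 with p ≠ 0, then from n
= deg p on T_{n+1}/T_n is cyclic and killed by the leading coefficient of p, hence of length zero;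
so finitely generated submodules have trajectories of bounded length. A submodule F of finite length
need not be finitely generated, but upper continuity gives a finitely generated G with (G + F)/G of
length at most ε, and passing from G to F costs at most nε on the n-th trajectory
(`length_trajectory_le`). -/

theorem trajectory_succ {R M : Type u} [Ring R] [AddCommGroup M] [Module R M]
    (φ : Module.End R M) (F : Submodule R M) (n : ℕ) :
    trajectory φ F (n + 1) = trajectory φ F n ⊔ F.map (φ ^ n) := by
  simp [trajectory, Finset.range_add_one, sup_comm]

theorem trajectory_zero {R M : Type u} [Ring R] [AddCommGroup M] [Module R M]
    (φ : Module.End R M) (F : Submodule R M) : trajectory φ F 0 = ⊥ := by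
  simp [trajectory]

theorem map_pow_le_trajectory {R M : Type u} [Ring R] [AddCommGroup M] [Module R M]
    (φ : Module.End R M) (F : Submodule R M) {k n : ℕ} (h : k < n) :
    F.map (φ ^ k) ≤ trajectory φ F n :=
  Finset.le_sup (f := fun k => F.map (φ ^ k)) (Finset.mem_range.2 h)

theorem trajectory_mono {R M : Type u} [Ring R] [AddCommGroup M] [Module R M]
    (φ : Module.End R M) (F : Submodule R M) {m n : ℕ} (h : m ≤ n) :
    trajectory φ F m ≤ trajectory φ F n :=
  Finset.sup_mono (Finset.range_mono h)

theorem trajectory_sup {R M : Type u} [Ring R] [AddCommGroup M] [Module R M]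
    (φ : Module.End R M) (F G : Submodule R M) (n : ℕ) :
    trajectory φ (F ⊔ G) n = trajectory φ F n ⊔ trajectory φ G n := by
  simp only [trajectory, Submodule.map_sup]
  exact Finset.sup_sup

/-- The length of `(A + B) / A`, the image of `B` in `M / A`. -/
noncomputable def relLength {R M : Type u} [Ring R] [AddCommGroup M] [Module R M]
    (i : ModuleCat.{u} R → ℝ≥0∞) (A B : Submodule R M) : ℝ≥0∞ :=
  i (ModuleCat.of R (B.map A.mkQ))

/-! ### Relative length, approximation and cyclic modules -/

namespace IsLengthFunction

section Ring

variable {R : Type u} [Ring R] {i : ModuleCat.{u} R → ℝ≥0∞} {M : Type u} [AddCommGroup M]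
  [Module R M]

theorem bot_eq_zero (hi : IsLengthFunction i) : i (ModuleCat.of R (⊥ : Submodule R M)) = 0 :=
  hi.zero _ (inferInstanceAs (Subsingleton (⊥ : Submodule R M)))

theorem mono (hi : IsLengthFunction i) {A B : Submodule R M} (h : A ≤ B) :
    i (ModuleCat.of R A) ≤ i (ModuleCat.of R B) := by
  rw [hi.additive (ModuleCat.of R B) (A.submoduleOf B),
    ← hi.of_equiv (Submodule.submoduleOfEquivOfLe h)]
  exact le_self_add

theorem eq_ker_add_of_surjective (hi : IsLengthFunction i) {N : Type u} [AddCommGroup N]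
    [Module R N] (f : M →ₗ[R] N) (hf : Function.Surjective f) :
    i (ModuleCat.of R M) = i (ModuleCat.of R (LinearMap.ker f)) + i (ModuleCat.of R N) := by
  rw [← hi.of_equiv (f.quotKerEquivOfSurjective hf)]
  exact hi.additive (ModuleCat.of R M) (LinearMap.ker f)

theorem length_sup (hi : IsLengthFunction i) (A B : Submodule R M) :
    i (ModuleCat.of R (A ⊔ B : Submodule R M)) = i (ModuleCat.of R A) + relLength i A B := by
  have hm : (A ⊔ B).map A.mkQ = B.map A.mkQ := by
    rw [Submodule.map_sup, Submodule.mkQ_map_self, bot_sup_eq]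
  have hk : LinearMap.ker (A.mkQ.submoduleMap (A ⊔ B)) = A.submoduleOf (A ⊔ B) := by
    ext x
    simp [Submodule.submoduleOf, LinearMap.mem_ker, Subtype.ext_iff]
  rw [hi.eq_ker_add_of_surjective (A.mkQ.submoduleMap (A ⊔ B))
    (LinearMap.submoduleMap_surjective _ _), hk, hm,
    hi.of_equiv (Submodule.submoduleOfEquivOfLe (le_sup_left : A ≤ A ⊔ B))]
  rfl

theorem relLength_anti (hi : IsLengthFunction i) {A A' : Submodule R M} (h : A ≤ A')
    (B : Submodule R M) : relLength i A' B ≤ relLength i A B := by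
  have e : B.map A'.mkQ = (B.map A.mkQ).map (Submodule.factor h) := by
    rw [← Submodule.map_comp, Submodule.factor_comp_mk]
  unfold relLength
  rw [e]
  exact hi.le_of_surjective ((Submodule.factor h).submoduleMap _)
    (LinearMap.submoduleMap_surjective _ _)

/-- The map g induces a surjection from (A + B)/A onto (gA + gB)/gA. -/
theorem relLength_map_le (hi : IsLengthFunction i) (g : M →ₗ[R] M) (A B : Submodule R M) :
    relLength i (A.map g) (B.map g) ≤ relLength i A B := by
  have e : (B.map g).map (A.map g).mkQ =
      (B.map A.mkQ).map (A.mapQ (A.map g) g (Submodule.le_comap_map g A)) := by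
    rw [← Submodule.map_comp, ← Submodule.map_comp, Submodule.mapQ_mkQ]
  unfold relLength
  rw [e]
  exact hi.le_of_surjective (LinearMap.submoduleMap _ _)
    (LinearMap.submoduleMap_surjective _ _)

theorem relLength_sup_le (hi : IsLengthFunction i) (A B C : Submodule R M) :
    relLength i A (B ⊔ C) ≤ relLength i A B + relLength i A C := by
  unfold relLength
  rw [Submodule.map_sup]
  exact hi.sup_le_add _ _

/-- The new term φⁿ(G) is measured modulo a trajectory containing φⁿ(F), so each step costs at most
the relative length of G over F. -/
theorem relLength_trajectory_le (hi : IsLengthFunction i) (φ : Module.End R M)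
    (F G : Submodule R M) (n : ℕ) :
    relLength i (trajectory φ F n) (trajectory φ G n) ≤ n * relLength i F G := by
  induction n with
  | zero =>
    rw [trajectory_zero φ G]
    unfold relLength
    rw [Submodule.map_bot, hi.bot_eq_zero]
    exact zero_le
  | succ n ih =>
    rw [trajectory_succ φ G]
    refine (hi.relLength_sup_le _ _ _).trans ?_
    push_cast
    rw [add_mul, one_mul]
    exact add_le_add ((hi.relLength_anti (trajectory_mono φ F n.le_succ) _).trans ih)
      ((hi.relLength_anti (map_pow_le_trajectory φ F n.lt_succ_self) _).trans
        (hi.relLength_map_le _ _ _))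

theorem length_trajectory_le (hi : IsLengthFunction i) (φ : Module.End R M)
    (F G : Submodule R M) (n : ℕ) :
    i (ModuleCat.of R (trajectory φ G n)) ≤
      i (ModuleCat.of R (trajectory φ F n)) + n * relLength i F G := by
  refine (hi.mono (le_sup_right (a := trajectory φ F n))).trans ?_
  rw [hi.length_sup]
  gcongr
  exact hi.relLength_trajectory_le φ F G n

/-- A submodule of finite length is approximated by its finitely generated submodules. -/
theorem exists_fg_relLength_le (hi : IsLengthFunction i) (F : Submodule R M)
    (hF : i (ModuleCat.of R F) ≠ ∞) {ε : ℝ≥0∞} (hε : ε ≠ 0) :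
    ∃ G : Submodule R M, G.FG ∧ relLength i G F ≤ ε := by
  -- Length zero is treated apart because the strict inequality i(F) - ε < i(F) fails there.
  by_cases h0 : i (ModuleCat.of R F) = 0
  · refine ⟨⊥, Submodule.fg_bot, ?_⟩
    have h := hi.length_sup ⊥ F
    rw [bot_sup_eq, h0] at h
    rw [(add_eq_zero.1 h.symm).2]
    exact zero_le
  have hlt : i (ModuleCat.of R F) - ε < i (ModuleCat.of R F) := ENNReal.sub_lt_self hF h0 hε
  conv_rhs at hlt => rw [hi.upperContinuous (ModuleCat.of R F)]
  obtain ⟨G, hG⟩ := lt_iSup_iff.1 hlt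
  obtain ⟨hfg, hG⟩ := lt_iSup_iff.1 hG
  refine ⟨G.map F.subtype, hfg.map _, ?_⟩
  have h := hi.length_sup (G.map F.subtype) F
  rw [sup_eq_right.2 (Submodule.map_subtype_le F G),
    ← hi.of_equiv (Submodule.equivSubtypeMap F G)] at h
  have hGfin : i (ModuleCat.of R G) ≠ ∞ := fun hG' => hF (by rw [h, hG', top_add])
  have h2 : i (ModuleCat.of R F) ≤ i (ModuleCat.of R G) + ε := by
    rw [add_comm]
    exact tsub_le_iff_left.1 hG.le
  rw [h] at h2
  exact (ENNReal.add_le_add_iff_left hGfin).1 h2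

theorem length_span_singleton_le (hi : IsLengthFunction i) (x : M) :
    i (ModuleCat.of R (R ∙ x)) ≤ i (ModuleCat.of R R) := by
  rw [← LinearMap.range_toSpanSingleton]
  exact hi.le_of_surjective (LinearMap.toSpanSingleton R M x).rangeRestrict
    (LinearMap.surjective_rangeRestrict _)

theorem length_fg_eq_zero (hi : IsLengthFunction i) (h : i (ModuleCat.of R R) = 0)
    (F : Submodule R M) (hF : F.FG) : i (ModuleCat.of R F) = 0 := by
  induction F, hF using Submodule.fg_induction with
  | singleton x => exact le_antisymm (h ▸ hi.length_span_singleton_le x) zero_le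
  | sup A B _ _ hA hB =>
    refine le_antisymm ((hi.sup_le_add A B).trans ?_) zero_le
    rw [hA, hB, add_zero]

/-- If i(R) were zero, i would vanish on cyclic modules, then on finitely generated ones, then
everywhere by upper continuity. -/
theorem length_ring_ne_zero (hi : IsLengthFunction i) (h : ∃ M : ModuleCat.{u} R, i M ≠ 0) :
    i (ModuleCat.of R R) ≠ 0 := by
  obtain ⟨M, hM⟩ := h
  contrapose! hM
  rw [hi.upperContinuous]
  simp only [ENNReal.iSup_eq_zero]
  exact fun F hF => hi.length_fg_eq_zero hM F hF

theorem relLength_singleton (A : Submodule R M) (x : M) :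
    relLength i A (R ∙ x) = i (ModuleCat.of R (R ∙ A.mkQ x)) := by
  unfold relLength
  rw [Submodule.map_span, Set.image_singleton]

end Ring

section Domain

variable {R : Type u} [CommRing R] {i : ModuleCat.{u} R → ℝ≥0∞} {M : Type u}
  [AddCommGroup M] [Module R M]

theorem length_span_singleton_of_injective (hi : IsLengthFunction i) (x : M)
    (hx : ∀ r : R, r • x = 0 → r = 0) :
    i (ModuleCat.of R (R ∙ x)) = i (ModuleCat.of R R) := by
  rw [← LinearMap.range_toSpanSingleton]
  refine (hi.of_equiv (LinearEquiv.ofInjective (LinearMap.toSpanSingleton R M x) ?_)).symm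
  exact (injective_iff_map_eq_zero _).2 fun r hr => hx r hr

variable [IsDomain R]

/-- The annihilator of x contains rR ≅ R, so it already has full length i(R); finiteness of i(R)
allows cancellation in i(R) = i(Ann x) + i(Rx). -/
theorem length_span_singleton_of_torsion (hi : IsLengthFunction i)
    (hiR : i (ModuleCat.of R R) ≠ ∞) (x : M) {r : R} (hr : r ≠ 0) (hx : r • x = 0) :
    i (ModuleCat.of R (R ∙ x)) = 0 := by
  have h := hi.eq_ker_add_of_surjective (LinearMap.toSpanSingleton R M x).rangeRestrict
    (LinearMap.surjective_rangeRestrict _)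
  rw [LinearMap.ker_rangeRestrict, LinearMap.range_toSpanSingleton] at h
  have h1 : i (ModuleCat.of R R) ≤
      i (ModuleCat.of R (LinearMap.ker (LinearMap.toSpanSingleton R M x))) := by
    rw [← hi.length_span_singleton_of_injective r
      fun s hs => (mul_eq_zero.1 hs).resolve_right hr]
    refine hi.mono ?_
    rw [Submodule.span_singleton_le_iff_mem]
    exact hx
  have h2 : i (ModuleCat.of R R) + i (ModuleCat.of R (R ∙ x)) ≤ i (ModuleCat.of R R) + 0 := by
    rw [add_zero]
    exact (add_le_add_left h1 _).trans h.ge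
  exact le_antisymm ((ENNReal.add_le_add_iff_left hiR).1 h2) zero_le

end Domain

end IsLengthFunction

/-! ### Polynomials and trajectories of cyclic submodules -/

section Domain

variable {R : Type u} [CommRing R] {i : ModuleCat.{u} R → ℝ≥0∞}

theorem pow_apply_mem_trajectory {M : Type u} [AddCommGroup M] [Module R M]
    (φ : Module.End R M) (x : M) {k n : ℕ} (h : k < n) :
    (φ ^ k) x ∈ trajectory φ (R ∙ x) n :=
  map_pow_le_trajectory φ _ h (Submodule.mem_map_of_mem (Submodule.mem_span_singleton_self x))

theorem exists_degree_lt_of_mem_trajectory {M : Type u} [AddCommGroup M] [Module R M]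
    (φ : Module.End R M) (x : M) {n : ℕ} {y : M} (hy : y ∈ trajectory φ (R ∙ x) n) :
    ∃ q : R[X], q.degree < n ∧ aeval φ q x = y := by
  have h : trajectory φ (R ∙ x) n ≤
      (degreeLT R n).map ((LinearMap.applyₗ x : Module.End R M →ₗ[R] M) ∘ₗ
        (aeval φ : R[X] →ₐ[R] Module.End R M).toLinearMap) := by
    refine Finset.sup_le fun k hk => ?_
    rw [Submodule.map_span, Set.image_singleton, Submodule.span_singleton_le_iff_mem]
    refine ⟨Polynomial.X ^ k, ?_, by simp⟩
    rw [SetLike.mem_coe, mem_degreeLT]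
    exact (degree_X_pow_le k).trans_lt (by exact_mod_cast Finset.mem_range.1 hk)
  obtain ⟨q, hq, hqy⟩ := h hy
  exact ⟨q, mem_degreeLT.1 hq, hqy⟩

/-- Apply φ^m, with m = n - deg p, to p(φ)(x) = 0 and solve for the top term. -/
theorem leadingCoeff_smul_pow_apply_mem_trajectory {M : Type u} [AddCommGroup M] [Module R M]
    (φ : Module.End R M) (x : M) {p : R[X]} (hx : aeval φ p x = 0) {n : ℕ}
    (hn : p.natDegree ≤ n) : p.leadingCoeff • (φ ^ n) x ∈ trajectory φ (R ∙ x) n := by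
  obtain ⟨m, rfl⟩ := Nat.exists_eq_add_of_le hn
  have h : aeval φ (Polynomial.X ^ m * p) x = 0 := by simp [hx]
  rw [map_mul, aeval_eq_sum_range (p := p), Finset.sum_range_succ, mul_add, LinearMap.add_apply] at h
  have e : p.leadingCoeff • (φ ^ (p.natDegree + m)) x =
      (aeval φ (Polynomial.X ^ m : R[X]) * (p.coeff p.natDegree • φ ^ p.natDegree)) x := by
    rw [add_comm, pow_add]
    simp
  rw [e, eq_neg_of_add_eq_zero_right h, Finset.mul_sum, LinearMap.sum_apply]
  refine Submodule.neg_mem _ (Submodule.sum_mem _ fun k hk => ?_)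
  have e' : (aeval φ (Polynomial.X ^ m : R[X]) * (p.coeff k • φ ^ k)) x =
      p.coeff k • (φ ^ (k + m)) x := by
    rw [add_comm, pow_add]
    simp
  rw [e']
  exact Submodule.smul_mem _ _ (pow_apply_mem_trajectory φ x
    (by have := Finset.mem_range.1 hk; omega))

theorem coe_aeval_restrict (X : Flow R) (N : Submodule R X.carrier) (hN : ∀ x ∈ N, X.map x ∈ N)
    (p : R[X]) (x : N) :
    ((aeval (X.map.restrict hN) p x : N) : X.carrier) = aeval X.map p x := by
  induction p using Polynomial.induction_on' with
  | add p q hp hq => simp [hp, hq]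
  | monomial n a =>
    rw [aeval_monomial, aeval_monomial, Module.End.pow_restrict _]
    simp [Module.algebraMap_end_apply]

theorem length_trajectory_eq (hi : IsLengthFunction i) (X : Flow R) (x : X.carrier)
    (hx : ∀ p : R[X], aeval X.map p x = 0 → p = 0) (n : ℕ) :
    i (ModuleCat.of R (trajectory X.map (R ∙ x) n)) = n * i (ModuleCat.of R R) := by
  induction n with
  | zero => rw [trajectory_zero, hi.bot_eq_zero]; simp
  | succ n ih =>
    rw [trajectory_succ, hi.length_sup, Submodule.map_span, Set.image_singleton,
      IsLengthFunction.relLength_singleton, ih, Nat.cast_succ, add_mul, one_mul,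
      hi.length_span_singleton_of_injective]
    intro r hr
    rw [← map_smul, Submodule.mkQ_apply, Submodule.Quotient.mk_eq_zero] at hr
    obtain ⟨q, hq, hqx⟩ := exists_degree_lt_of_mem_trajectory X.map x hr
    -- Since deg q < n, the coefficient of X^n in this annihilating polynomial is r, which forces r
    -- = 0: the new quotient is free.
    have h := hx (C r * Polynomial.X ^ n - q) (by simp [hqx, Module.algebraMap_end_apply])
    have h' := congrArg (fun p => p.coeff n) h
    simpa [coeff_eq_zero_of_degree_lt hq] using h'

/-! ### Zero entropy and pointwise algebraicity -/

theorem pointwiseAlgebraic_of_entropy_eq_zero (hi : IsLengthFunction i)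
    (hi0 : i (ModuleCat.of R R) ≠ 0) (hiR : i (ModuleCat.of R R) < ∞) (X : Flow R)
    (hX : entropy i X = 0) : X.PointwiseAlgebraic := by
  by_contra hna
  simp only [Flow.PointwiseAlgebraic, not_forall, not_exists, not_and'] at hna
  obtain ⟨x, hx⟩ := hna
  have hx' : ∀ p : R[X], aeval X.map p x = 0 → p = 0 := fun p hp => not_not.1 (hx p hp)
  simp only [entropy, ENNReal.iSup_eq_zero] at hX
  have hfin := (hi.length_span_singleton_le x).trans_lt hiR
  have hlim := tendsto_entropyAt hi X (R ∙ x) hfin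
  rw [hX _ hfin] at hlim
  -- The normalised lengths equal i(R) for all n > 0, yet tend to 0.
  refine hi0 (tendsto_nhds_unique (tendsto_const_nhds.congr' ?_) hlim)
  filter_upwards [eventually_gt_atTop 0] with n hn
  rw [length_trajectory_eq hi X x hx' n, mul_comm,
    ENNReal.mul_div_cancel_right (by exact_mod_cast hn.ne') (by simp)]

variable [IsDomain R]

/-- The trajectories of a finitely generated submodule have bounded length when `φ` is pointwise
algebraic. -/
theorem exists_length_trajectory_le (hi : IsLengthFunction i) (hiR : i (ModuleCat.of R R) < ∞)
    (X : Flow R) (hX : X.PointwiseAlgebraic) (F : Submodule R X.carrier) (hF : F.FG) :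
    ∃ C : ℝ≥0∞, C ≠ ∞ ∧ ∀ n, i (ModuleCat.of R (trajectory X.map F n)) ≤ C := by
  induction F, hF using Submodule.fg_induction with
  | singleton x =>
    obtain ⟨p, hp, hx⟩ := hX x
    have hstep : ∀ n, i (ModuleCat.of R (trajectory X.map (R ∙ x) (n + 1))) =
        i (ModuleCat.of R (trajectory X.map (R ∙ x) n)) +
          i (ModuleCat.of R (R ∙ (trajectory X.map (R ∙ x) n).mkQ ((X.map ^ n) x))) := by
      intro n
      rw [trajectory_succ, hi.length_sup, Submodule.map_span, Set.image_singleton,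
        IsLengthFunction.relLength_singleton]
    -- Each of the first deg p steps costs at most i(R); all later ones cost nothing.
    refine ⟨p.natDegree * i (ModuleCat.of R R), ENNReal.mul_ne_top (by simp) hiR.ne, fun n => ?_⟩
    have hle : ∀ n : ℕ, i (ModuleCat.of R (trajectory X.map (R ∙ x) n)) ≤
        n * i (ModuleCat.of R R) := by
      intro n
      induction n with
      | zero => rw [trajectory_zero, hi.bot_eq_zero]; exact zero_le
      | succ n ih =>
        rw [hstep, Nat.cast_succ, add_mul, one_mul]
        exact add_le_add ih (hi.length_span_singleton_le _)
    rcases le_total n p.natDegree with hn | hn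
    · exact (hi.mono (trajectory_mono _ _ hn)).trans (hle _)
    · induction n, hn using Nat.le_induction with
      | base => exact hle _
      | succ n hn ih =>
        rw [hstep, hi.length_span_singleton_of_torsion hiR.ne _ (leadingCoeff_ne_zero.2 hp),
          add_zero]
        · exact ih
        · rw [← map_smul, Submodule.mkQ_apply, Submodule.Quotient.mk_eq_zero]
          exact leadingCoeff_smul_pow_apply_mem_trajectory X.map x hx hn
  | sup A B _ _ hA hB =>
    obtain ⟨C, hC, hA⟩ := hA
    obtain ⟨D, hD, hB⟩ := hB
    refine ⟨C + D, ENNReal.add_ne_top.2 ⟨hC, hD⟩, fun n => ?_⟩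
    rw [trajectory_sup]
    exact (hi.sup_le_add _ _).trans (add_le_add (hA n) (hB n))

theorem entropy_eq_zero_of_pointwiseAlgebraic (hi : IsLengthFunction i)
    (hiR : i (ModuleCat.of R R) < ∞) (X : Flow R) (hX : X.PointwiseAlgebraic) :
    entropy i X = 0 := by
  simp only [entropy, ENNReal.iSup_eq_zero]
  intro F hF
  refine le_antisymm (le_of_forall_pos_le_add fun ε hε => ?_) zero_le
  rw [zero_add]
  obtain ⟨G, hG, hGF⟩ := hi.exists_fg_relLength_le F hF.ne hε.ne'
  obtain ⟨C, hC, hCG⟩ := exists_length_trajectory_le hi hiR X hX G hG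
  have h0 : Tendsto (fun n : ℕ => C / n) atTop (𝓝 0) := by
    simpa using ENNReal.Tendsto.const_div ENNReal.tendsto_nat_nhds_top (Or.inr hC)
  -- Here C/n bounds the contribution of G and ε the cost per step of replacing G by F.
  have hlim : Tendsto (fun n : ℕ => C / n + ε) atTop (𝓝 ε) := by
    simpa using h0.add_const ε
  refine le_of_tendsto_of_tendsto (tendsto_entropyAt hi X F hF) hlim ?_
  filter_upwards [eventually_gt_atTop 0] with n hn
  refine ENNReal.div_le_of_le_mul ?_
  have hn0 : (n : ℝ≥0∞) ≠ 0 := by exact_mod_cast hn.ne'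
  rw [add_mul, ENNReal.div_mul_cancel hn0 (ENNReal.natCast_ne_top n), mul_comm ε]
  refine (hi.length_trajectory_le X.map G F n).trans ?_
  gcongr
  exact hCG n

theorem entropy_eq_zero_iff (hi : IsLengthFunction i) (hi0 : ∃ M : ModuleCat.{u} R, i M ≠ 0)
    (hiR : i (ModuleCat.of R R) < ∞) (X : Flow R) :
    entropy i X = 0 ↔ X.PointwiseAlgebraic :=
  ⟨pointwiseAlgebraic_of_entropy_eq_zero hi (hi.length_ring_ne_zero hi0) hiR X,
    entropy_eq_zero_of_pointwiseAlgebraic hi hiR X⟩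

theorem pointwiseAlgebraic_restrict_iff (X : Flow R) (N : Submodule R X.carrier)
    (hN : ∀ x ∈ N, X.map x ∈ N) :
    (X.restrict N hN).PointwiseAlgebraic ↔ N ≤ algebraicRadical X := by
  have key : ∀ (p : R[X]) (x : N), aeval (X.map.restrict hN) p x = 0 ↔ aeval X.map p x = 0 :=
    fun p x => by rw [← coe_aeval_restrict X N hN, ZeroMemClass.coe_eq_zero]
  constructor
  · intro h x hx
    obtain ⟨p, hp, hpx⟩ := h ⟨x, hx⟩
    exact ⟨p, hp, (key p ⟨x, hx⟩).1 hpx⟩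
  · intro h x
    obtain ⟨p, hp, hpx⟩ := h x.2
    exact ⟨p, hp, (key p x).2 hpx⟩

end Domain

end AlgFlow

theorem corollary5p18 {R : Type u} [CommRing R] [IsDomain R] (i : ModuleCat.{u} R → ℝ≥0∞)
    (hi : AlgFlow.IsLengthFunction i) (hi0 : ∃ M : ModuleCat.{u} R, i M ≠ 0)
    (hiR : i (ModuleCat.of R R) < ∞) :
    (AlgFlow.pinskerRadical (AlgFlow.entropy i) =
      fun X : AlgFlow.Flow R => AlgFlow.algebraicRadical X) ∧
    ∀ X : AlgFlow.Flow R, AlgFlow.entropy i X = 0 ↔ X.PointwiseAlgebraic := by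
  refine ⟨?_, AlgFlow.entropy_eq_zero_iff hi hi0 hiR⟩
  funext X
  -- For the second inclusion, 𝔚 is itself one of the submodules being joined.
  refine le_antisymm (sSup_le ?_) (le_sSup ⟨AlgFlow.algebraicRadical_invariant X, ?_⟩)
  · rintro N ⟨hN, h⟩
    exact (AlgFlow.pointwiseAlgebraic_restrict_iff X N hN).1
      ((AlgFlow.entropy_eq_zero_iff hi hi0 hiR _).1 h)
  · exact (AlgFlow.entropy_eq_zero_iff hi hi0 hiR _).2
      ((AlgFlow.pointwiseAlgebraic_restrict_iff X _ _).2 le_rfl)
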